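/- Let $1\le m<n$ and let $P$ be an $n\times n$ matrix with nonnegative real entries of the partitioned form $$P=\begin{pmatrix}Q&0\\R&T\end{pmatrix},$$ where $Q$ is an $m\times m$ primitive matrix, i.e. $Q$ is nonnegative, irreducible (the $1\times1$ zero matrix being counted as reducible) and has only one (complex) eigenvalue of maximum modulus. Let $\gamma(Q)$, the index of primitivity of $Q$, be the least integer $k\ge1$ such that all entries of $Q^k$ are positive. Suppose that for every $i\in\{m+1,\dots,n\}$ there exist $j\in\{1,\dots,m\}$ and a path of $P$ from $i$ to $j$, i.e. indices $i=i_0,i_1,\dots,i_u=j$ with $u\ge1$ and $P_{i_{v-1}i_v}>0$ for $v=1,\dots,u$. Then the first $m$ columns of $$P^{\gamma(Q)(n-m+1)}$$ are positive (all their entries are $>0$) and, more generally, the first $m$ columns of $P^{t(n-m+1)}$ are positive for all integers $t\ge\gamma(Q)$. -/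

import Mathlib

namespace NonnegMat

/-- All entries are nonnegative. -/
def Nonneg {m n : ℕ} (P : Matrix (Fin m) (Fin n) ℝ) : Prop :=
  ∀ i j, 0 ≤ P i j

/-- All entries are (strictly) positive. -/
def Pos {m n : ℕ} (P : Matrix (Fin m) (Fin n) ℝ) : Prop :=
  ∀ i j, 0 < P i j

/-- `μ : ℂ` is an eigenvalue of the real square matrix `Q`. -/
def IsEigenvalue {m : ℕ} (Q : Matrix (Fin m) (Fin m) ℝ) (μ : ℂ) : Prop :=
  Module.End.HasEigenvalue (Matrix.toLin' (Q.map (fun x : ℝ => (x : ℂ)))) μ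

/-- `μ` is an eigenvalue of `Q` whose modulus is maximal among the eigenvalues of `Q`. -/
def IsMaxModulusEigenvalue {m : ℕ} (Q : Matrix (Fin m) (Fin m) ℝ) (μ : ℂ) : Prop :=
  IsEigenvalue Q μ ∧ ∀ ν : ℂ, IsEigenvalue Q ν → ‖ν‖ ≤ ‖μ‖

/-- A nonnegative square matrix is primitive if it is irreducible and has only one eigenvalue of
maximum modulus. (`Matrix.IsIrreducible` includes nonnegativity, and the `1 × 1` zero matrix
is not irreducible in that sense.) -/
def Primitive {m : ℕ} (Q : Matrix (Fin m) (Fin m) ℝ) : Prop :=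
  Q.IsIrreducible ∧ ∃! μ : ℂ, IsMaxModulusEigenvalue Q μ

/-- The index of primitivity: the least `k ≥ 1` such that `Q ^ k` is positive. -/
noncomputable def primitivityIndex {m : ℕ} (Q : Matrix (Fin m) (Fin m) ℝ) : ℕ :=
  sInf {k : ℕ | 1 ≤ k ∧ Pos (Q ^ k)}

/-- There is a path `i = i₀, i₁, …, i_u = j`, of some length `u ≥ 1`, with
`P i₀ i₁, P i₁ i₂, …, P i_{u-1} i_u > 0`. -/
def HasPath {n : ℕ} (P : Matrix (Fin n) (Fin n) ℝ) (i j : Fin n) : Prop :=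
  ∃ u : ℕ, 1 ≤ u ∧ ∃ p : Fin (u + 1) → Fin n,
    p 0 = i ∧ p (Fin.last u) = j ∧ ∀ k : Fin u, 0 < P (p k.castSucc) (p k.succ)

/-- The order-preserving identification of the `m` first and the `n - m` last indices with the
`n` indices. -/
def blockEquiv {m n : ℕ} (h : m ≤ n) : Fin m ⊕ Fin (n - m) ≃ Fin n :=
  finSumFinEquiv.trans (finCongr (Nat.add_sub_cancel' h))

/-- The `n × n` matrix with the partitioned form `[[Q, 0], [R, T]]`, where `Q` is `m × m`. -/
def lowerBlock {m n : ℕ} (h : m ≤ n) (Q : Matrix (Fin m) (Fin m) ℝ)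
    (R : Matrix (Fin (n - m)) (Fin m) ℝ) (T : Matrix (Fin (n - m)) (Fin (n - m)) ℝ) :
    Matrix (Fin n) (Fin n) ℝ :=
  Matrix.reindex (blockEquiv h) (blockEquiv h) (Matrix.fromBlocks Q 0 R T)

/-- The first `m` columns of `P` are positive. -/
def FirstColsPos {n : ℕ} (m : ℕ) (P : Matrix (Fin n) (Fin n) ℝ) : Prop :=
  ∀ i j : Fin n, (j : ℕ) < m → 0 < P i j

end NonnegMat

/-! Positivity of an entry of `P ^ k` means that a walk of length `k` exists. From any index, a
shortest walk to the first `m` indices has length `u ≤ n - m`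
(`exists_pow_apply_pos_le_card_compl`). The remaining `t * (n - m + 1) - u ≥ t` steps stay in the
block `Q`, whose powers from `γ(Q)` onwards are all positive (`pos_pow_of_le`). That `γ(Q)` exists
is Frobenius' theorem: if `d` is the gcd of the closed walk lengths at a vertex, the spectrum is
invariant under rotation by `2π/d`, so a unique eigenvalue of maximum modulus forces `d = 1`. -/

/-- An entry of a product of nonnegative matrices is positive iff one of its terms is. -/
lemma Matrix.mul_apply_pos_iff {V : Type*} [Fintype V] {A B : Matrix V V ℝ}
    (hA : ∀ i j, 0 ≤ A i j) (hB : ∀ i j, 0 ≤ B i j) (i j : V) :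
    0 < (A * B) i j ↔ ∃ k, 0 < A i k ∧ 0 < B k j := by
  rw [Matrix.mul_apply, Finset.sum_pos_iff_of_nonneg fun k _ => mul_nonneg (hA i k) (hB k j)]
  constructor
  · rintro ⟨k, -, hk⟩
    exact ⟨k, pos_of_mul_pos_left hk (hB k j), pos_of_mul_pos_right hk (hA i k)⟩
  · rintro ⟨k, h₁, h₂⟩
    exact ⟨k, Finset.mem_univ k, mul_pos h₁ h₂⟩

namespace NonnegMat

section Walks

variable {V : Type*} [Fintype V] [DecidableEq V] {A : Matrix V V ℝ}

lemma pow_add_apply_pos (hA : ∀ i j, 0 ≤ A i j) {a b : ℕ} {i k j : V}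
    (h₁ : 0 < (A ^ a) i k) (h₂ : 0 < (A ^ b) k j) : 0 < (A ^ (a + b)) i j := by
  rw [pow_add, Matrix.mul_apply_pos_iff (Matrix.pow_apply_nonneg hA a)
    (Matrix.pow_apply_nonneg hA b)]
  exact ⟨k, h₁, h₂⟩

lemma pow_succ_apply_pos_iff (hA : ∀ i j, 0 ≤ A i j) (a : ℕ) (i j : V) :
    0 < (A ^ (a + 1)) i j ↔ ∃ k, 0 < A i k ∧ 0 < (A ^ a) k j := by
  rw [pow_succ', Matrix.mul_apply_pos_iff hA (Matrix.pow_apply_nonneg hA a)]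

lemma pow_apply_pos_of_walk (hA : ∀ i j, 0 ≤ A i j) (u : ℕ) (p : Fin (u + 1) → V)
    (hp : ∀ k : Fin u, 0 < A (p k.castSucc) (p k.succ)) :
    0 < (A ^ u) (p 0) (p (Fin.last u)) := by
  induction u with
  | zero => simp
  | succ u ih =>
    rw [pow_succ_apply_pos_iff hA]
    refine ⟨p 1, by simpa using hp 0, ?_⟩
    simpa using ih (fun k => p k.succ) fun k => by simpa using hp k.succ

/-- If the set `S` can be reached from everywhere, it can be reached in at most `#Sᶜ` steps. -/
lemma exists_pow_apply_pos_le_card_compl (hA : ∀ i j, 0 ≤ A i j) (S : Finset V)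
    (hS : ∀ i, ∃ u, ∃ j ∈ S, 0 < (A ^ u) i j) (i : V) :
    ∃ u ≤ Sᶜ.card, ∃ j ∈ S, 0 < (A ^ u) i j := by
  classical
  let d : V → ℕ := fun i => Nat.find (hS i)
  have hd : ∀ i, ∃ j ∈ S, 0 < (A ^ d i) i j := fun i => Nat.find_spec (hS i)
  have hle : ∀ i u, (∃ j ∈ S, 0 < (A ^ u) i j) → d i ≤ u := fun i u h => Nat.find_min' (hS i) h
  -- Distance to `S` drops by exactly one along a shortest walk, so every value in `1..u` is
  -- attained off `S`.
  have level : ∀ u k, d k = u → Finset.Icc 1 u ⊆ Sᶜ.image d := by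
    intro u
    induction u with
    | zero => simp
    | succ u ih =>
      intro k hk v hv
      obtain ⟨j, hjS, hj⟩ := hd k
      rw [hk, pow_succ_apply_pos_iff hA] at hj
      obtain ⟨l, hkl, hlj⟩ := hj
      have h₁ : d l ≤ u := hle l u ⟨j, hjS, hlj⟩
      have h₂ : d k ≤ d l + 1 := by
        obtain ⟨j', hj'S, hj'⟩ := hd l
        exact hle k _ ⟨j', hj'S, (pow_succ_apply_pos_iff hA _ _ _).2 ⟨l, hkl, hj'⟩⟩
      rw [Finset.mem_Icc] at hv
      rcases eq_or_lt_of_le hv.2 with rfl | hlt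
      · refine Finset.mem_image.2 ⟨k, Finset.mem_compl.2 fun hkS => ?_, hk⟩
        have := hle k 0 ⟨k, hkS, by simp⟩
        omega
      · exact ih l (by omega) (Finset.mem_Icc.2 ⟨hv.1, by omega⟩)
  refine ⟨d i, ?_, hd i⟩
  have := (Finset.card_le_card (level (d i) i rfl)).trans Finset.card_image_le
  simpa using this

end Walks

section Primitive

variable {V : Type*} [Fintype V] [DecidableEq V] {A : Matrix V V ℝ}

/-- An irreducible matrix with a diagonal position at which all large powers are positive has
an entrywise positive power. -/
lemma exists_pow_pos_of_eventually_diag_pos (hA : A.IsIrreducible) (v : V) (N : ℕ)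
    (hN : ∀ k ≥ N, 0 < (A ^ k) v v) : ∃ k ≥ 1, ∀ i j, 0 < (A ^ k) i j := by
  have h0 := hA.nonneg
  have hc := (Matrix.isIrreducible_iff_exists_pow_pos h0).1 hA
  choose a _ ha using fun i => hc i v
  choose b _ hb using fun j => hc v j
  obtain ⟨s, hs⟩ : ∃ s, ∀ i, a i ≤ s :=
    ⟨∑ i, a i, fun i => Finset.single_le_sum (fun _ _ => Nat.zero_le _) (Finset.mem_univ i)⟩
  obtain ⟨t, ht⟩ : ∃ t, ∀ j, b j ≤ t :=
    ⟨∑ j, b j, fun j => Finset.single_le_sum (fun _ _ => Nat.zero_le _) (Finset.mem_univ j)⟩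
  refine ⟨s + (N + 1) + t, by omega, fun i j => ?_⟩
  have := pow_add_apply_pos h0 (pow_add_apply_pos h0 (ha i)
    (hN ((s - a i) + (N + 1) + (t - b j)) (by omega))) (hb j)
  have hi := hs i
  have hj := ht j
  rwa [show a i + (s - a i + (N + 1) + (t - b j)) + b j = s + (N + 1) + t by omega] at this

/-- If all closed walks through `v` have length divisible by `d`, the spectrum of an irreducible
matrix is invariant under multiplication by `d`-th roots of unity. -/
lemma hasEigenvalue_mul_of_dvd_closed_walks (hA : A.IsIrreducible) (v : V) (d : ℕ)
    (hd : ∀ k, 0 < (A ^ k) v v → d ∣ k) {ω : ℂ} (hω : ω ^ d = 1) (hω0 : ω ≠ 0) {μ : ℂ}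
    (hμ : Module.End.HasEigenvalue (Matrix.toLin' (A.map (fun x : ℝ => (x : ℂ)))) μ) :
    Module.End.HasEigenvalue (Matrix.toLin' (A.map (fun x : ℝ => (x : ℂ)))) (ω * μ) := by
  have h0 := hA.nonneg
  have hc := (Matrix.isIrreducible_iff_exists_pow_pos h0).1 hA
  choose a _ ha using fun i => hc v i
  choose b _ hb using fun j => hc j v
  -- Both `a i + 1 + b j` and `a j + b j` are closed walk lengths at `v`, so `a j ≡ a i + 1` mod
  -- `d`. With `D = diag (ω ^ a i)` this says `A D = ω D A`.
  have key : ∀ i j, 0 < A i j → ω ^ a j = ω * ω ^ a i := by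
    intro i j hij
    obtain ⟨x, hx⟩ := hd _ (pow_add_apply_pos h0 (pow_add_apply_pos h0 (ha i)
      (show 0 < (A ^ 1) i j by simpa using hij)) (hb j))
    obtain ⟨y, hy⟩ := hd _ (pow_add_apply_pos h0 (ha j) (hb j))
    have e₁ : ω ^ (a i + 1) * ω ^ b j = 1 := by rw [← pow_add, hx, pow_mul, hω, one_pow]
    have e₂ : ω ^ a j * ω ^ b j = 1 := by rw [← pow_add, hy, pow_mul, hω, one_pow]
    rw [← pow_succ']
    exact mul_right_cancel₀ (pow_ne_zero (b j) hω0) (e₂.trans e₁.symm)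
  obtain ⟨x, hx⟩ := hμ.exists_hasEigenvector
  have hxe := hx.apply_eq_smul
  refine Module.End.hasEigenvalue_of_hasEigenvector (x := fun i => ω ^ a i * x i)
    (Module.End.hasEigenvector_iff.2 ⟨Module.End.mem_eigenspace_iff.2 ?_, ?_⟩)
  · ext i
    have hxi := congrFun hxe i
    simp only [Matrix.toLin'_apply, Matrix.mulVec, dotProduct, Matrix.map_apply, Pi.smul_apply,
      smul_eq_mul] at hxi ⊢
    calc ∑ j, (A i j : ℂ) * (ω ^ a j * x j)
        = ∑ j, ω * ω ^ a i * ((A i j : ℂ) * x j) := by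
          refine Finset.sum_congr rfl fun j _ => ?_
          rcases (h0 i j).eq_or_lt with h | h
          · simp [← h]
          · rw [key i j h]; ring
      _ = ω * μ * (ω ^ a i * x i) := by rw [← Finset.mul_sum, hxi]; ring
  · intro h
    refine hx.2 (funext fun i => ?_)
    simpa [pow_ne_zero _ hω0] using congrFun h i

/-- An endomorphism of a finite-dimensional complex space without nonzero eigenvalues is
nilpotent. -/
lemma isNilpotent_of_hasEigenvalue_eq_zero {E : Type*} [AddCommGroup E] [Module ℂ E]
    [FiniteDimensional ℂ E] (f : Module.End ℂ E) (hf : ∀ μ, f.HasEigenvalue μ → μ = 0) :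
    IsNilpotent f := by
  have htop : f.maxGenEigenspace 0 = ⊤ := by
    rw [← Module.End.iSup_maxGenEigenspace_eq_top f]
    refine le_antisymm (le_iSup f.maxGenEigenspace 0) (iSup_le fun μ => ?_)
    by_cases hμ : μ = 0
    · rw [hμ]
    · have : f.maxGenEigenspace μ = ⊥ := by
        by_contra h
        refine hμ (hf μ ?_)
        rw [Module.End.maxGenEigenspace_eq f μ] at h
        exact Module.End.hasEigenvalue_of_hasGenEigenvalue
          (k := f.maxGenEigenspaceIndex μ) h
      simp [this]
  rw [Module.End.maxGenEigenspace_eq f 0] at htop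
  refine ⟨f.maxGenEigenspaceIndex 0, LinearMap.ext fun x => ?_⟩
  have hx : x ∈ f.genEigenspace 0 (f.maxGenEigenspaceIndex 0) := htop ▸ Submodule.mem_top
  simpa [Module.End.mem_genEigenspace_nat] using hx

/-- An irreducible matrix has a nonzero eigenvalue. -/
lemma exists_hasEigenvalue_ne_zero [Nonempty V] (hA : A.IsIrreducible) :
    ∃ μ : ℂ, Module.End.HasEigenvalue (Matrix.toLin' (A.map (fun x : ℝ => (x : ℂ)))) μ ∧
      μ ≠ 0 := by
  by_contra! h
  obtain ⟨k, hk⟩ := isNilpotent_of_hasEigenvalue_eq_zero _ h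
  obtain ⟨v⟩ := ‹Nonempty V›
  obtain ⟨c, hc, hpos⟩ := (Matrix.isIrreducible_iff_exists_pow_pos hA.nonneg).1 hA v v
  -- Repeating a closed walk gives arbitrarily long ones, which nilpotency forbids.
  have hmul : ∀ l : ℕ, 0 < (A ^ (c * l)) v v := by
    intro l
    induction l with
    | zero => simp
    | succ l ih => exact pow_add_apply_pos hA.nonneg ih hpos
  have hzero : A ^ k = 0 := by
    rw [← Matrix.toLin'_pow, LinearEquiv.map_eq_zero_iff] at hk
    have hmap : (A ^ k).map (fun x : ℝ => (x : ℂ)) = 0 := by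
      rw [← hk]
      exact Matrix.map_pow A Complex.ofRealHom k
    ext i j
    simpa using congrFun (congrFun hmap i) j
  have := hmul k
  rw [show c * k = k + (c - 1) * k by
    obtain ⟨e, rfl⟩ : ∃ e, c = e + 1 := ⟨c - 1, by omega⟩
    rw [Nat.add_sub_cancel]; ring, pow_add, hzero, zero_mul] at this
  simp at this

end Primitive

/-- Frobenius: some power of a primitive matrix is positive. -/
theorem Primitive.exists_pow_pos {m : ℕ} (hm : 1 ≤ m) {Q : Matrix (Fin m) (Fin m) ℝ}
    (hQ : Primitive Q) : ∃ k, 1 ≤ k ∧ Pos (Q ^ k) := by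
  obtain ⟨hirr, μ, ⟨hμ, hmax⟩, huniq⟩ := hQ
  let v : Fin m := ⟨0, hm⟩
  have : Nonempty (Fin m) := ⟨v⟩
  let S : Set ℕ := {k | 0 < (Q ^ k) v v}
  have hμ0 : μ ≠ 0 := by
    rintro rfl
    obtain ⟨ν, hν, hν0⟩ := exists_hasEigenvalue_ne_zero hirr
    exact hν0 (by simpa using hmax ν hν)
  have hd0 : Nat.setGcd S ≠ 0 := by
    rw [Ne, Nat.setGcd_eq_zero_iff]
    intro h
    obtain ⟨c, hc, hpos⟩ := (Matrix.isIrreducible_iff_exists_pow_pos hirr.nonneg).1 hirr v v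
    exact hc.ne' (h hpos)
  have hω := Complex.isPrimitiveRoot_exp _ hd0
  set ω := Complex.exp (2 * Real.pi * Complex.I / (Nat.setGcd S : ℂ))
  have hω1 : ω = 1 := by
    have hev : IsEigenvalue Q (ω * μ) := hasEigenvalue_mul_of_dvd_closed_walks hirr v _
      (fun k hk => Nat.setGcd_dvd_of_mem hk) hω.pow_eq_one (hω.ne_zero hd0) hμ
    have := huniq (ω * μ) ⟨hev, fun ν hν => by
      rw [norm_mul, hω.norm'_eq_one hd0, one_mul]; exact hmax ν hν⟩
    exact mul_right_cancel₀ hμ0 (this.trans (one_mul μ).symm)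
  have hd1 : Nat.setGcd S = 1 := by
    rw [hω1] at hω
    exact hω.unique IsPrimitiveRoot.one
  -- All large multiples of the gcd are sums of elements of `S`, and closed walks at `v`
  -- concatenate.
  obtain ⟨N, hN⟩ := Nat.exists_mem_closure_of_ge S
  have hclosure : ∀ k ∈ AddSubmonoid.closure S, 0 < (Q ^ k) v v := fun k hk => by
    induction hk using AddSubmonoid.closure_induction with
    | mem x hx => exact hx
    | zero => simp
    | add x y _ _ hx hy => exact pow_add_apply_pos hirr.nonneg hx hy
  exact exists_pow_pos_of_eventually_diag_pos hirr v N fun k hk =>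
    hclosure k (hN k hk (hd1 ▸ one_dvd k))

/-- All powers of an irreducible matrix from a positive one onwards are positive. -/
lemma pos_pow_of_le {m : ℕ} {Q : Matrix (Fin m) (Fin m) ℝ} (hQ : Q.IsIrreducible) {g t : ℕ}
    (hg : Pos (Q ^ g)) (ht : g ≤ t) : Pos (Q ^ t) := by
  induction t, ht using Nat.le_induction with
  | base => exact hg
  | succ t _ ih =>
    intro i j
    -- Only the first step of a closed walk matters: row `i` of `Q` has a positive entry.
    obtain ⟨c, hc, hpos⟩ := (Matrix.isIrreducible_iff_exists_pow_pos hQ.nonneg).1 hQ i i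
    obtain ⟨c, rfl⟩ : ∃ e, c = e + 1 := ⟨c - 1, by omega⟩
    obtain ⟨k, hk, -⟩ := (pow_succ_apply_pos_iff hQ.nonneg c i i).1 hpos
    exact (pow_succ_apply_pos_iff hQ.nonneg t i j).2 ⟨k, hk, ih k j⟩

lemma lowerBlock_apply_castLE {m n : ℕ} (h : m ≤ n) (Q : Matrix (Fin m) (Fin m) ℝ)
    (R : Matrix (Fin (n - m)) (Fin m) ℝ) (T : Matrix (Fin (n - m)) (Fin (n - m)) ℝ)
    (i j : Fin m) : lowerBlock h Q R T (i.castLE h) (j.castLE h) = Q i j := by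
  have key : ∀ i : Fin m, (blockEquiv h).symm (i.castLE h) = Sum.inl i := fun i => by
    rw [Equiv.symm_apply_eq]
    ext
    simp [blockEquiv]
  simp [lowerBlock, key]

lemma pow_castLE_pos {m n : ℕ} (h : m ≤ n) {P : Matrix (Fin n) (Fin n) ℝ} (hP : Nonneg P)
    {Q : Matrix (Fin m) (Fin m) ℝ} (hQ : Nonneg Q)
    (hPQ : ∀ i j, P (i.castLE h) (j.castLE h) = Q i j) (k : ℕ) (i j : Fin m)
    (hk : 0 < (Q ^ k) i j) : 0 < (P ^ k) (i.castLE h) (j.castLE h) := by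
  induction k generalizing i with
  | zero =>
    obtain rfl : i = j := by
      by_contra hne
      simp [Matrix.one_apply_ne hne] at hk
    simp
  | succ k ih =>
    obtain ⟨l, hil, hlj⟩ := (pow_succ_apply_pos_iff hQ k i j).1 hk
    exact (pow_succ_apply_pos_iff hP k _ _).2 ⟨l.castLE h, by rwa [hPQ], ih l hlj⟩

end NonnegMat

theorem theorem5p10 (n m : ℕ) (hm : 1 ≤ m) (hmn : m < n)
    (P : Matrix (Fin n) (Fin n) ℝ) (hP : NonnegMat.Nonneg P)
    (Q : Matrix (Fin m) (Fin m) ℝ) (R : Matrix (Fin (n - m)) (Fin m) ℝ)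
    (T : Matrix (Fin (n - m)) (Fin (n - m)) ℝ)
    (hblock : P = NonnegMat.lowerBlock hmn.le Q R T)
    (hQ : NonnegMat.Primitive Q)
    (hpath : ∀ i : Fin n, m ≤ (i : ℕ) → ∃ j : Fin n, (j : ℕ) < m ∧ NonnegMat.HasPath P i j) :
    NonnegMat.FirstColsPos m (P ^ (NonnegMat.primitivityIndex Q * (n - m + 1))) ∧
      ∀ t : ℕ, NonnegMat.primitivityIndex Q ≤ t →
        NonnegMat.FirstColsPos m (P ^ (t * (n - m + 1))) := by
  suffices H : ∀ t : ℕ, NonnegMat.primitivityIndex Q ≤ t →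
      NonnegMat.FirstColsPos m (P ^ (t * (n - m + 1))) from ⟨H _ le_rfl, H⟩
  intro t ht i j hj
  -- Frobenius' theorem rules out the default value `sInf ∅ = 0`.
  obtain ⟨hg1, hg⟩ : 1 ≤ NonnegMat.primitivityIndex Q ∧
      NonnegMat.Pos (Q ^ NonnegMat.primitivityIndex Q) := Nat.sInf_mem (hQ.exists_pow_pos hm)
  let S : Finset (Fin n) := Finset.univ.map (Fin.castLEEmb hmn.le)
  have memS : ∀ k : Fin n, (k : ℕ) < m → k ∈ S := fun k hk =>
    Finset.mem_map.2 ⟨⟨k, hk⟩, Finset.mem_univ _, rfl⟩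
  have hS : S.card = m := by simp [S]
  obtain ⟨u, hu, k, hk, hik⟩ := NonnegMat.exists_pow_apply_pos_le_card_compl hP S (fun i => by
    rcases lt_or_ge (i : ℕ) m with hi | hi
    · exact ⟨0, i, memS i hi, by simp⟩
    · obtain ⟨j, hj, u, -, p, rfl, rfl, hp⟩ := hpath i hi
      exact ⟨u, _, memS _ hj, NonnegMat.pow_apply_pos_of_walk hP u p hp⟩) i
  rw [Finset.card_compl, hS, Fintype.card_fin] at hu
  obtain ⟨k, -, rfl⟩ := Finset.mem_map.1 hk
  -- Uses `u ≤ n - m` and `t ≥ 1`.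
  have hlen : u + t ≤ t * (n - m + 1) := by nlinarith
  have hkj := NonnegMat.pow_castLE_pos hmn.le hP hQ.1.nonneg
    (fun i j => by rw [hblock, NonnegMat.lowerBlock_apply_castLE]) (t * (n - m + 1) - u) k ⟨j, hj⟩
    (NonnegMat.pos_pow_of_le hQ.1 hg (by omega) _ _)
  have := NonnegMat.pow_add_apply_pos hP hik hkj
  rwa [Nat.add_sub_cancel' (by omega)] at this
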